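/- For an integer $d\ge 1$ let $\mathbb{D}^d=\{z\in\mathbb{C}^d:|z_1|,\dots,|z_d|<1\}$ and let the Schur class $\mathcal{S}_d$ be the set of all analytic functions $f:\mathbb{D}^d\to\overline{\mathbb{D}}$. For $f\in\mathcal{S}_d$ with power series $f(z)=\sum_\alpha f_\alpha z^\alpha$ and a $d$-tuple $T=(T_1,\dots,T_d)$ of commuting strictly contractive operators on a complex Hilbert space (that is, $T_iT_j=T_jT_i$ and $\|T_i\|<1$), put $f(T)=\sum_\alpha f_\alpha T^\alpha$, which converges absolutely. The Schur–Agler class $\mathcal{A}_d$ is the set of $f\in\mathcal{S}_d$ with $\|f(T)\|\le 1$ for all such $T$ on all Hilbert spaces. With $f_r(z)=f(rz)$, the Schur–Agler radius is \[ SA_d=\sup\{0<r\le 1: f_r\in\mathcal{A}_d\text{ for all }f\in\mathcal{S}_d\}. \] Theorem. There exists a constant $c>0$ such that for every integer $d\ge 2$ \[ SA_d\le c\left(\frac{\log d}{d}\right)^{1/4}. \] -/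

import Mathlib

universe u

/-- The open unit polydisk in `ℂ^d`. -/
def polydisk (d : ℕ) : Set (Fin d → ℂ) := {z | ∀ i, ‖z i‖ < 1}

/-- The Schur class of the polydisk: the functions that are analytic on the polydisk and map it
into the closed unit disk. (Values outside the polydisk play no role.) -/
def schurClass (d : ℕ) : Set ((Fin d → ℂ) → ℂ) :=
  {f | AnalyticOnNhd ℂ f (polydisk d) ∧ ∀ z ∈ polydisk d, ‖f z‖ ≤ 1}

/-- `a` is the family of power series coefficients of `f` on the polydisk, that is,
`f z = ∑ α, a α * z ^ α` for every `z` in the polydisk. Every function that is analytic on the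
polydisk has exactly one such family. -/
def IsPowerSeriesOf {d : ℕ} (a : (Fin d →₀ ℕ) → ℂ) (f : (Fin d → ℂ) → ℂ) : Prop :=
  ∀ z ∈ polydisk d, HasSum (fun α : Fin d →₀ ℕ => a α * ∏ i, z i ^ α i) (f z)

/-- The operator monomial `T ^ α = T₁ ^ α₁ ⋯ T_d ^ α_d`. -/
noncomputable def opMonomial {d : ℕ} {H : Type u} [NormedAddCommGroup H] [InnerProductSpace ℂ H]
    (T : Fin d → H →L[ℂ] H) (α : Fin d →₀ ℕ) : H →L[ℂ] H :=
  (List.ofFn fun i => T i ^ α i).prod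

/-- The operator `f(T) = ∑ α, a α • T ^ α`, where `a` is the family of power series coefficients
of `f`. The series converges absolutely for strict contractions, see `summable_opEval`. -/
noncomputable def opEval {d : ℕ} {H : Type u} [NormedAddCommGroup H] [InnerProductSpace ℂ H]
    (a : (Fin d →₀ ℕ) → ℂ) (T : Fin d → H →L[ℂ] H) : H →L[ℂ] H :=
  ∑' α : Fin d →₀ ℕ, a α • opMonomial T α

theorem norm_opMonomial_le {d : ℕ} {H : Type u} [NormedAddCommGroup H] [InnerProductSpace ℂ H]
    (T : Fin d → H →L[ℂ] H) (α : Fin d →₀ ℕ) : ‖opMonomial T α‖ ≤ ∏ i, ‖T i‖ ^ α i := by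
  have pow_le : ∀ (A : H →L[ℂ] H) (n : ℕ), ‖A ^ n‖ ≤ ‖A‖ ^ n := by
    intro A n
    rcases Nat.eq_zero_or_pos n with rfl | hn
    · rw [pow_zero, pow_zero]
      exact ContinuousLinearMap.norm_id_le
    · exact norm_pow_le' A hn
  have key : ∀ l : List (H →L[ℂ] H), ‖l.prod‖ ≤ (l.map norm).prod := by
    intro l
    induction l with
    | nil => exact ContinuousLinearMap.norm_id_le
    | cons A l ih =>
      simp only [List.prod_cons, List.map_cons]
      exact (norm_mul_le _ _).trans (mul_le_mul_of_nonneg_left ih (norm_nonneg _))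
  refine (key _).trans ?_
  rw [List.map_ofFn, List.prod_ofFn]
  exact Finset.prod_le_prod (fun i _ => norm_nonneg _) (fun i _ => pow_le _ _)

theorem summable_opEval {d : ℕ} {H : Type u} [NormedAddCommGroup H] [InnerProductSpace ℂ H]
    [CompleteSpace H] {a : (Fin d →₀ ℕ) → ℂ} {f : (Fin d → ℂ) → ℂ} (h : IsPowerSeriesOf a f)
    {T : Fin d → H →L[ℂ] H} (hT : ∀ i, ‖T i‖ < 1) :
    Summable fun α : Fin d →₀ ℕ => a α • opMonomial T α := by
  have hz : (fun i => ((‖T i‖ : ℝ) : ℂ)) ∈ polydisk d := by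
    intro i
    simpa using hT i
  refine Summable.of_norm_bounded (h _ hz).summable.norm fun α => ?_
  rw [norm_smul, norm_mul, norm_prod]
  refine mul_le_mul_of_nonneg_left ((norm_opMonomial_le T α).trans (le_of_eq ?_)) (norm_nonneg _)
  exact Finset.prod_congr rfl fun i _ => by simp

/-- The Schur-Agler class of the polydisk: the functions `f` of the Schur class with
`‖f(T)‖ ≤ 1` for all `d`-tuples `T` of commuting strict contractions on a Hilbert space. -/
def schurAglerClass (d : ℕ) : Set ((Fin d → ℂ) → ℂ) :=
  {f | f ∈ schurClass d ∧ ∀ a : (Fin d →₀ ℕ) → ℂ, IsPowerSeriesOf a f →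
    ∀ (H : Type u) [NormedAddCommGroup H] [InnerProductSpace ℂ H] [CompleteSpace H]
      (T : Fin d → H →L[ℂ] H), (∀ i j, Commute (T i) (T j)) → (∀ i, ‖T i‖ < 1) →
      ‖opEval a T‖ ≤ 1}

/-- The dilation `f_r(z) = f(rz)`. -/
def dilation {d : ℕ} (f : (Fin d → ℂ) → ℂ) (r : ℝ) : (Fin d → ℂ) → ℂ :=
  fun z => f fun i => (r : ℂ) * z i

/-- The Schur-Agler radius `SA_d = sup {r > 0 : f_r ∈ 𝒜_d for all f ∈ 𝒮_d}`. Here `r ≤ 1`, as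
`f_r` is defined on the polydisk only for such `r`. -/
noncomputable def schurAglerRadius (d : ℕ) : ℝ :=
  sSup {r : ℝ | 0 < r ∧ r ≤ 1 ∧ ∀ f ∈ schurClass d, dilation f r ∈ schurAglerClass.{u} d}

/-! A Schur function is played off against commuting contractions on which it is large. Put k = 2m +
1 and let B be a family of k-subsets of the variables, any two meeting in at most m points. Graphs
of polynomials of degree at most m over a field of q elements give such a B with q ^ (m + 1)
members, provided k ≤ q and kq ≤ d.

On the scalar side, random signs make ∑ ε_c z^c small: its supremum on the polydisk is at most 2^k ·
4 √(|B| (d + 1)) (`exists_signs_blockPoly`).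

On the operator side, commuting strict contractions send one unit vector e to 2^(-k) ε_c e' under
every monomial c ∈ B, with the same unit vector e' (`opMonomial_blockOp`). They collect m indices of
a block, pass to the complementary m indices while using one more, and then delete these. Sparsity
is what keeps the norms bounded: m + 1 indices determine the block, so the passage is a weighted
partial permutation. Since ε_c² = 1, the terms of the polynomial add up without cancellation.

Comparing the two sides gives r^k |B| ≤ 4^k · 4 √(|B| (d + 1)). As |B|² ≥ q^k, the choice k ≈ log d
turns (d + 1)² into C^k, so r^4 ≤ C / q; finally q ≈ d / k by Bertrand's postulate. -/

/-! ### Random signs and the supremum norm -/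

open Finset in
/-- Chernoff's bound and the union bound: signs for which finitely many signed sums are small. -/
theorem exists_signs {κ Ω : Type*} [Fintype κ] [DecidableEq κ] [Fintype Ω] (b : Ω → κ → ℝ)
    {N l : ℝ} (hN : 0 < N) (hl : 0 ≤ l) (hb : ∀ ω, ∑ c, b ω c ^ 2 ≤ N)
    (h : 2 * (Fintype.card Ω : ℝ) < Real.exp (l ^ 2 / (2 * N))) :
    ∃ ε : κ → ℝ, (∀ c, ε c = 1 ∨ ε c = -1) ∧ ∀ ω, |∑ c, ε c * b ω c| ≤ l := by
  classical
  set sg : Bool → ℝ := fun t => if t then 1 else -1 with hsg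
  by_contra! hcon
  -- This value minimizes the exponent μ²N/2 - μl in Chernoff's bound.
  set μ := l / N with hμ
  have hμ0 : 0 ≤ μ := div_nonneg hl hN.le
  have mgf : ∀ (ν : ℝ) (ω : Ω), ∑ t : κ → Bool, Real.exp (ν * ∑ c, sg (t c) * b ω c) ≤
      2 ^ Fintype.card κ * Real.exp (ν ^ 2 * N / 2) := by
    intro ν ω
    have e1 : ∑ t : κ → Bool, Real.exp (ν * ∑ c, sg (t c) * b ω c) =
        ∏ c, ∑ s : Bool, Real.exp (ν * (sg s * b ω c)) := by
      rw [prod_univ_sum, Fintype.piFinset_univ]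
      refine sum_congr rfl fun t _ => ?_
      rw [mul_sum, Real.exp_sum]
    rw [e1]
    calc ∏ c, ∑ s : Bool, Real.exp (ν * (sg s * b ω c))
        ≤ ∏ c, (2 * Real.exp ((ν * b ω c) ^ 2 / 2)) := by
          refine prod_le_prod (fun c _ => by positivity) fun c _ => ?_
          have := Real.cosh_le_exp_half_sq (ν * b ω c)
          rw [Real.cosh_eq] at this
          simp only [hsg, Fintype.sum_bool, if_true, one_mul, Bool.false_eq_true, if_false,
            neg_mul, mul_neg]
          linarith
      _ = 2 ^ Fintype.card κ * Real.exp (ν ^ 2 * (∑ c, b ω c ^ 2) / 2) := by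
          rw [prod_mul_distrib, prod_const, card_univ, ← Real.exp_sum]
          congr 2
          rw [mul_sum, sum_div]
          exact sum_congr rfl fun c _ => by ring
      _ ≤ _ := by
          gcongr
          exact hb ω
  -- If every choice of signs fails for some ω, one of the two exponentials at that ω already
  -- exceeds exp (μl). Summing over all signs contradicts `mgf`.
  have low : ∀ t : κ → Bool, Real.exp (μ * l) ≤ ∑ ω, (Real.exp (μ * ∑ c, sg (t c) * b ω c) +
      Real.exp (-μ * ∑ c, sg (t c) * b ω c)) := by
    intro t
    obtain ⟨ω, hω⟩ := hcon (fun c => sg (t c)) fun c => by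
      cases t c <;> simp [hsg]
    refine le_trans ?_ (single_le_sum (f := fun ω => Real.exp (μ * ∑ c, sg (t c) * b ω c) +
      Real.exp (-μ * ∑ c, sg (t c) * b ω c)) (fun ω _ => by positivity) (mem_univ ω))
    rcases le_abs.1 hω.le with h1 | h1
    · have : Real.exp (μ * l) ≤ Real.exp (μ * ∑ c, sg (t c) * b ω c) := by gcongr
      have := Real.exp_pos (-μ * ∑ c, sg (t c) * b ω c)
      linarith
    · have : Real.exp (μ * l) ≤ Real.exp (-μ * ∑ c, sg (t c) * b ω c) := by
        rw [neg_mul, ← mul_neg]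
        gcongr
      have := Real.exp_pos (μ * ∑ c, sg (t c) * b ω c)
      linarith
  have tot : 2 ^ Fintype.card κ * Real.exp (μ * l) ≤
      Fintype.card Ω * (2 * (2 ^ Fintype.card κ * Real.exp (μ ^ 2 * N / 2))) := by
    calc 2 ^ Fintype.card κ * Real.exp (μ * l) = ∑ _t : κ → Bool, Real.exp (μ * l) := by simp
      _ ≤ _ := sum_le_sum fun t _ => low t
      _ = ∑ ω, (∑ t : κ → Bool, Real.exp (μ * ∑ c, sg (t c) * b ω c) +
          ∑ t : κ → Bool, Real.exp (-μ * ∑ c, sg (t c) * b ω c)) := by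
        rw [sum_comm]
        exact sum_congr rfl fun ω _ => sum_add_distrib
      _ ≤ ∑ _ω : Ω, 2 * (2 ^ Fintype.card κ * Real.exp (μ ^ 2 * N / 2)) := by
        refine sum_le_sum fun ω _ => ?_
        have h1 := mgf μ ω
        have h2 := mgf (-μ) ω
        rw [neg_sq] at h2
        linarith
      _ = _ := by simp
  have e2 : Real.exp (μ * l) = Real.exp (l ^ 2 / (2 * N)) * Real.exp (μ ^ 2 * N / 2) := by
    rw [← Real.exp_add]
    congr 1
    rw [hμ]
    field_simp
    ring
  rw [e2] at tot
  have hp : (0 : ℝ) < 2 ^ Fintype.card κ * Real.exp (μ ^ 2 * N / 2) := by positivity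
  nlinarith [mul_lt_mul_of_pos_right h hp]

/-- The square-free polynomial with coefficients `ε c`, `c ∈ B`. -/
noncomputable def blockPoly {d : ℕ} (B : Finset (Finset (Fin d))) (ε : Finset (Fin d) → ℝ)
    (z : Fin d → ℂ) : ℂ :=
  ∑ c ∈ B, (ε c : ℂ) * ∏ i ∈ c, z i

/-- A square-free polynomial on the polydisk of radius `1 / 2` is bounded by its values at the
fourth roots of unity. -/
theorem norm_blockPoly_le_of_roots {d : ℕ} {B : Finset (Finset (Fin d))}
    {ε : Finset (Fin d) → ℝ} {K : ℝ}
    (hK : ∀ σ : Fin d → Fin 4, ‖blockPoly B ε fun i => Complex.I ^ (σ i : ℕ)‖ ≤ K)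
    {z : Fin d → ℂ} (hz : ∀ i, ‖z i‖ ≤ 1 / 2) : ‖blockPoly B ε z‖ ≤ K := by
  classical
  -- Barycentric weights of z i with respect to 1, i, -1, -i; they are nonnegative because the real
  -- and imaginary parts are at most 1/2 in modulus.
  set w : Fin d → Fin 4 → ℝ := fun i => ![1 / 4 + (z i).re / 2, 1 / 4 + (z i).im / 2,
    1 / 4 - (z i).re / 2, 1 / 4 - (z i).im / 2] with hw
  have hw0 : ∀ i j, 0 ≤ w i j := by
    intro i j
    have h1 := abs_le.1 ((Complex.abs_re_le_norm (z i)).trans (hz i))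
    have h2 := abs_le.1 ((Complex.abs_im_le_norm (z i)).trans (hz i))
    fin_cases j <;> simp [hw] <;> linarith
  have hw1 : ∀ i, ∑ j, w i j = 1 := by
    intro i
    simp [hw, Fin.sum_univ_four]
    ring
  have hwz : ∀ i, ∑ j, (w i j : ℂ) * Complex.I ^ (j : ℕ) = z i := by
    intro i
    apply Complex.ext <;> simp [hw, Fin.sum_univ_four, pow_succ] <;> ring
  -- The polynomial is affine in each variable, so its value at z is its mean for the product of the
  -- weights.
  have key : blockPoly B ε z = ∑ σ : Fin d → Fin 4, ((∏ i, w i (σ i) : ℝ) : ℂ) *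
      blockPoly B ε fun i => Complex.I ^ (σ i : ℕ) := by
    have mono : ∀ c : Finset (Fin d), ∏ i ∈ c, z i = ∑ σ : Fin d → Fin 4,
        ((∏ i, w i (σ i) : ℝ) : ℂ) * ∏ i ∈ c, Complex.I ^ (σ i : ℕ) := by
      intro c
      have e1 : ∏ i ∈ c, z i =
          ∏ i, ∑ j, (w i j : ℂ) * (if i ∈ c then Complex.I ^ (j : ℕ) else 1) := by
        rw [← Finset.prod_subset (Finset.subset_univ c)]
        · refine Finset.prod_congr rfl fun i hi => ?_
          simp only [hi, if_true, hwz]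
        · intro i _ hi
          simp only [hi, if_false, mul_one]
          exact_mod_cast hw1 i
      rw [e1, Finset.prod_univ_sum, Fintype.piFinset_univ]
      refine Finset.sum_congr rfl fun σ _ => ?_
      rw [Finset.prod_mul_distrib, Finset.prod_ite_mem, Finset.univ_inter]
      push_cast
      rfl
    simp only [blockPoly, mono, Finset.mul_sum]
    rw [Finset.sum_comm]
    exact Finset.sum_congr rfl fun σ _ => Finset.sum_congr rfl fun c _ => by ring
  have tot : ∑ σ : Fin d → Fin 4, ∏ i, w i (σ i) = 1 := by
    have := Finset.prod_univ_sum (fun _ : Fin d => (Finset.univ : Finset (Fin 4))) w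
    rw [Fintype.piFinset_univ] at this
    rw [← this]
    simp [hw1]
  rw [key]
  calc _ ≤ ∑ σ : Fin d → Fin 4, (∏ i, w i (σ i)) * K := by
        refine norm_sum_le_of_le _ fun σ _ => ?_
        rw [norm_mul, Complex.norm_real, Real.norm_of_nonneg (Finset.prod_nonneg fun i _ => hw0 i _)]
        exact mul_le_mul_of_nonneg_left (hK σ) (Finset.prod_nonneg fun i _ => hw0 i _)
    _ = K := by rw [← Finset.sum_mul, tot, one_mul]

/-- There are signs for which a homogeneous square-free polynomial is small on the polydisk. -/
theorem exists_signs_blockPoly {d k : ℕ} {B : Finset (Finset (Fin d))} (hB : B.Nonempty)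
    (hk : ∀ c ∈ B, c.card = k) :
    ∃ ε : Finset (Fin d) → ℝ, (∀ c, ε c = 1 ∨ ε c = -1) ∧
      ∀ z ∈ polydisk d, ‖blockPoly B ε z‖ ≤ 2 ^ k * (4 * √(B.card * (d + 1))) := by
  classical
  -- Then l² / (2|B|) = 2(d + 1), and e² > 4 beats the union bound over 4^d points, real and
  -- imaginary parts, and both signs.
  set l : ℝ := 2 * √(B.card * (d + 1)) with hl
  have hN : (0 : ℝ) < B.card := by exact_mod_cast hB.card_pos
  let v : (Fin d → Fin 4) → Finset (Fin d) → ℂ := fun σ c => ∏ i ∈ c, Complex.I ^ (σ i : ℕ)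
  have hv : ∀ σ c, ‖v σ c‖ = 1 := fun σ c => by simp [v, norm_prod]
  obtain ⟨ε, hε, hle⟩ := exists_signs (Ω := (Fin d → Fin 4) × Bool)
    (fun ω c => if c ∈ B then (if ω.2 then (v ω.1 c).re else (v ω.1 c).im) else 0) hN
    (l := l) (by positivity)
    (by
      intro ω
      calc _ ≤ ∑ c : Finset (Fin d), if c ∈ B then (1 : ℝ) else 0 := by
            refine Finset.sum_le_sum fun c _ => ?_
            by_cases hc : c ∈ B
            · have h1 := Complex.abs_re_le_norm (v ω.1 c)
              have h2 := Complex.abs_im_le_norm (v ω.1 c)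
              rw [hv] at h1 h2
              simp only [hc, if_true]
              split_ifs
              · exact (sq_le_one_iff_abs_le_one _).2 h1
              · exact (sq_le_one_iff_abs_le_one _).2 h2
            · simp [hc]
        _ = B.card := by simp)
    (by
      have e1 : l ^ 2 / (2 * B.card) = 2 * ((d + 1 : ℕ) : ℝ) := by
        rw [hl, mul_pow, Real.sq_sqrt (by positivity)]
        push_cast
        field_simp
      rw [e1, Real.exp_mul, Real.rpow_natCast]
      have h4 : (4 : ℝ) < Real.exp 2 := by
        have : Real.exp 2 = Real.exp 1 * Real.exp 1 := by rw [← Real.exp_add]; norm_num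
        nlinarith [Real.exp_one_gt_d9]
      calc 2 * (Fintype.card ((Fin d → Fin 4) × Bool) : ℝ) = 4 ^ (d + 1) := by
            simp [pow_succ]
            ring
        _ < Real.exp 2 ^ (d + 1) := by gcongr)
  refine ⟨ε, hε, fun z hz => ?_⟩
  have hroots : ∀ σ : Fin d → Fin 4, ‖blockPoly B ε fun i => Complex.I ^ (σ i : ℕ)‖ ≤
      4 * √(B.card * (d + 1)) := by
    intro σ
    have h1 := hle (σ, true)
    have h2 := hle (σ, false)
    simp only [if_true, Bool.false_eq_true, if_false, mul_ite, mul_zero, Finset.sum_ite_mem,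
      Finset.univ_inter] at h1 h2
    refine (Complex.norm_le_abs_re_add_abs_im _).trans ?_
    have e1 : (blockPoly B ε fun i => Complex.I ^ (σ i : ℕ)).re = ∑ c ∈ B, ε c * (v σ c).re := by
      simp [blockPoly, v]
    have e2 : (blockPoly B ε fun i => Complex.I ^ (σ i : ℕ)).im = ∑ c ∈ B, ε c * (v σ c).im := by
      simp [blockPoly, v]
    rw [e1, e2]
    linarith
  -- Homogeneity moves z into the polydisk of radius 1/2 at the cost of 2^k.
  have hhom : blockPoly B ε z = 2 ^ k * blockPoly B ε fun i => z i / 2 := by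
    rw [blockPoly, blockPoly, Finset.mul_sum]
    refine Finset.sum_congr rfl fun c hc => ?_
    rw [Finset.prod_div_distrib, Finset.prod_const, hk c hc]
    field_simp
  rw [hhom, norm_mul, norm_pow, Complex.norm_ofNat]
  gcongr
  refine norm_blockPoly_le_of_roots hroots fun i => ?_
  rw [norm_div, Complex.norm_ofNat]
  linarith [hz i]

/-! ### Commuting contractions attached to a sparse family -/

/-- The index set of an orthonormal basis: a left and a right copy of the subsets of `Fin d`. -/
abbrev BlockNode (d : ℕ) : Type u := ULift.{u} (Finset (Fin d) ⊕ Finset (Fin d))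

namespace BlockNode

/-- The left copy of a set. -/
abbrev left {d : ℕ} (S : Finset (Fin d)) : BlockNode.{u} d := ⟨.inl S⟩

/-- The right copy of a set. -/
abbrev right {d : ℕ} (U : Finset (Fin d)) : BlockNode.{u} d := ⟨.inr U⟩

end BlockNode

open BlockNode

/-- The operator that inserts `a` into a left set of fewer than `m` elements, removes `a` from a
right set of at most `m` elements, and sends a left set `S` of `m` elements to the right sets `U`
of `m` elements disjoint from `S`, with coefficient `η (S ∪ {a} ∪ U)`. -/
def blockShift {d : ℕ} (m : ℕ) (η : Finset (Fin d) → ℂ) (a : Fin d) :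
    (BlockNode.{u} d → ℂ) →ₗ[ℂ] (BlockNode.{u} d → ℂ) where
  toFun x y := match y.down with
    | .inl S => if a ∈ S ∧ S.card ≤ m then x (left (S.erase a)) else 0
    | .inr U => if a ∈ U then 0 else if U.card < m then x (right (insert a U)) else
        if U.card = m then
          ∑ S with a ∉ S ∧ S.card = m ∧ Disjoint S U, η (insert a (S ∪ U)) * x (left S)
        else 0
  map_add' x x' := by
    ext ⟨S | U⟩
    · simp only [Pi.add_apply]
      split_ifs <;> simp
    · simp only [Pi.add_apply]
      split_ifs <;> simp [mul_add, Finset.sum_add_distrib]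
  map_smul' r x := by
    ext ⟨S | U⟩
    · simp only [Pi.smul_apply, smul_eq_mul, RingHom.id_apply]
      split_ifs <;> simp
    · simp only [Pi.smul_apply, smul_eq_mul, RingHom.id_apply]
      split_ifs <;> simp [Finset.mul_sum, mul_left_comm]

section

variable {d m : ℕ} {η : Finset (Fin d) → ℂ}

theorem blockShift_left (a : Fin d) (x : BlockNode.{u} d → ℂ) (S : Finset (Fin d)) :
    blockShift m η a x (left S) = if a ∈ S ∧ S.card ≤ m then x (left (S.erase a)) else 0 := rfl

theorem blockShift_right (a : Fin d) (x : BlockNode.{u} d → ℂ) (U : Finset (Fin d)) :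
    blockShift m η a x (right U) = if a ∈ U then 0 else
      if U.card < m then x (right (insert a U)) else if U.card = m then
        ∑ S with a ∉ S ∧ S.card = m ∧ Disjoint S U, η (insert a (S ∪ U)) * x (left S) else 0 := rfl

/-- Here b is collected on the left and a is used for the passage. The result is symmetric in a and
b, which is the heart of commutativity. -/
theorem blockShift_blockShift_right {a b : Fin d} (hab : a ≠ b) (x : BlockNode.{u} d → ℂ)
    {U : Finset (Fin d)} (ha : a ∉ U) (hb : b ∉ U) (hU : U.card = m) :
    blockShift m η a (blockShift m η b x) (right U) =
      ∑ S with a ∉ S ∧ b ∉ S ∧ S.card + 1 = m ∧ Disjoint S U,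
        η (insert a (insert b (S ∪ U))) * x (left S) := by
  rw [blockShift_right, if_neg ha, if_neg hU.not_lt, if_pos hU]
  simp only [blockShift_left, mul_ite, mul_zero]
  rw [← Finset.sum_filter, Finset.filter_filter]
  refine Finset.sum_nbij' (fun S => S.erase b) (fun S => insert b S) ?_ ?_ ?_ ?_ ?_
  · intro S hS
    simp only [Finset.mem_filter, Finset.mem_univ, true_and] at hS ⊢
    obtain ⟨⟨h1, h2, h3⟩, h4, -⟩ := hS
    exact ⟨fun h => h1 (Finset.mem_of_mem_erase h), Finset.notMem_erase _ _,
      by rw [Finset.card_erase_add_one h4, h2], h3.mono_left (Finset.erase_subset _ _)⟩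
  · intro S hS
    simp only [Finset.mem_filter, Finset.mem_univ, true_and] at hS ⊢
    obtain ⟨h1, h2, h3, h4⟩ := hS
    rw [Finset.card_insert_of_notMem h2]
    refine ⟨⟨?_, h3, ?_⟩, Finset.mem_insert_self _ _, h3.le⟩
    · simp [hab, h1]
    · simp [hb, h4]
  · intro S hS
    simp only [Finset.mem_filter, Finset.mem_univ, true_and] at hS
    exact Finset.insert_erase hS.2.1
  · intro S hS
    simp only [Finset.mem_filter, Finset.mem_univ, true_and] at hS
    exact Finset.erase_insert hS.2.1
  · intro S hS
    simp only [Finset.mem_filter, Finset.mem_univ, true_and] at hS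
    rw [← Finset.insert_union b, Finset.insert_erase hS.2.1]

/-- The coefficient of a passage depends only on the union of all indices involved, so it does not
record which index was used for the passage. No sparsity is needed. -/
theorem blockShift_comm (a b : Fin d) (x : BlockNode.{u} d → ℂ) :
    blockShift m η a (blockShift m η b x) = blockShift m η b (blockShift m η a x) := by
  rcases eq_or_ne a b with rfl | hab
  · rfl
  ext ⟨S | U⟩
  · change blockShift m η a _ (left S) = blockShift m η b _ (left S)
    simp only [blockShift_left]
    by_cases ha : a ∈ S <;> by_cases hb : b ∈ S <;> simp [ha, hb, hab, hab.symm]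
    rw [Finset.erase_right_comm]
  · change blockShift m η a _ (right U) = blockShift m η b _ (right U)
    by_cases ha : a ∈ U
    · rw [blockShift_right, if_pos ha, blockShift_right]
      split_ifs with hb h1 h2
      · rfl
      · rw [blockShift_right, if_pos (Finset.mem_insert_of_mem ha)]
      -- A nonzero term would need a ∈ S, but S is disjoint from U, which contains a.
      · symm
        refine Finset.sum_eq_zero fun S hS => ?_
        simp only [Finset.mem_filter, Finset.mem_univ, true_and] at hS
        rw [blockShift_left, if_neg, mul_zero]
        exact fun h => Finset.disjoint_left.1 hS.2.2 h.1 ha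
      · rfl
    by_cases hb : b ∈ U
    · rw [blockShift_right (a := b), if_pos hb, blockShift_right, if_neg ha]
      split_ifs with h1 h2
      · rw [blockShift_right, if_pos (Finset.mem_insert_of_mem hb)]
      · refine Finset.sum_eq_zero fun S hS => ?_
        simp only [Finset.mem_filter, Finset.mem_univ, true_and] at hS
        rw [blockShift_left, if_neg, mul_zero]
        exact fun h => Finset.disjoint_left.1 hS.2.2 h.1 hb
      · rfl
    rcases lt_trichotomy U.card m with h | h | h
    · have haI : a ∉ insert b U := by simp [hab, ha]
      have hbI : b ∉ insert a U := by simp [hab.symm, hb]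
      rw [blockShift_right a _ U, blockShift_right b _ U, if_neg ha, if_neg hb, if_pos h, if_pos h,
        blockShift_right, blockShift_right, if_neg haI, if_neg hbI, Finset.card_insert_of_notMem ha,
        Finset.card_insert_of_notMem hb, Finset.insert_comm a b U]
      split_ifs
      · rfl
      · refine Finset.sum_congr ?_ fun S _ => ?_
        · ext S
          simp only [Finset.mem_filter, Finset.mem_univ, true_and, Finset.disjoint_insert_right]
          tauto
        · simp only [Finset.union_insert]
          rw [Finset.insert_comm]
      · rfl
    · rw [blockShift_blockShift_right hab x ha hb h, blockShift_blockShift_right hab.symm x hb ha h]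
      refine Finset.sum_congr ?_ fun S _ => by rw [Finset.insert_comm]
      ext S
      simp only [Finset.mem_filter, Finset.mem_univ, true_and]
      tauto
    · rw [blockShift_right a _ U, blockShift_right b _ U, if_neg ha, if_neg hb, if_neg h.not_gt,
        if_neg h.not_gt, if_neg h.ne', if_neg h.ne']

/-- The sets on which `η` does not vanish have pairwise at most `m` common elements. -/
def IsSparse (m : ℕ) (η : Finset (Fin d) → ℂ) : Prop :=
  ∀ c c', η c ≠ 0 → η c' ≠ 0 → m < (c ∩ c').card → c = c'

/-- Both blocks contain the m + 1 elements of `insert a S`, hence coincide, and removing these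
elements leaves U and U'. -/
theorem IsSparse.union_inj (hη : IsSparse m η) {a : Fin d} {S U U' : Finset (Fin d)}
    (hS : S.card = m) (haS : a ∉ S) (haU : a ∉ U) (haU' : a ∉ U') (hU : Disjoint S U)
    (hU' : Disjoint S U') (h : η (insert a (S ∪ U)) ≠ 0) (h' : η (insert a (S ∪ U')) ≠ 0) :
    U = U' := by
  have e : insert a (S ∪ U) = insert a (S ∪ U') := by
    refine hη _ _ h h' ?_
    have h1 : insert a S ⊆ insert a (S ∪ U) ∩ insert a (S ∪ U') :=
      Finset.subset_inter (Finset.insert_subset_insert _ Finset.subset_union_left)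
        (Finset.insert_subset_insert _ Finset.subset_union_left)
    have h2 := Finset.card_le_card h1
    rw [Finset.card_insert_of_notMem haS] at h2
    omega
  ext y
  have h3 := Finset.ext_iff.1 e y
  simp only [Finset.mem_insert, Finset.mem_union] at h3
  have h4 : y ∈ U → y ∉ S := fun hy hyS => Finset.disjoint_left.1 hU hyS hy
  have h5 : y ∈ U' → y ∉ S := fun hy hyS => Finset.disjoint_left.1 hU' hyS hy
  have h6 : y ∈ U → y ≠ a := fun hy hya => haU (hya ▸ hy)
  have h7 : y ∈ U' → y ≠ a := fun hy hya => haU' (hya ▸ hy)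
  tauto

theorem blockShift_single_left {a : Fin d} {S : Finset (Fin d)} (ha : a ∉ S) (hS : S.card < m) :
    blockShift m η a (Pi.single (left.{u} S) 1) = Pi.single (left (insert a S)) 1 := by
  ext ⟨S' | U⟩
  · change blockShift m η a _ (left S') = _
    rw [blockShift_left]
    by_cases h : S' = insert a S
    · subst h
      simp [ha, Finset.card_insert_of_notMem, Nat.succ_le_of_lt hS]
    · have : a ∈ S' → S'.erase a ≠ S := by
        rintro h1 rfl
        exact h (Finset.insert_erase h1).symm
      by_cases h1 : a ∈ S' <;> simp_all
  · change blockShift m η a _ (right U) = _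
    rw [blockShift_right]
    have : ∀ S' ∈ Finset.univ.filter (fun S' : Finset (Fin d) =>
        a ∉ S' ∧ S'.card = m ∧ Disjoint S' U),
        η (insert a (S' ∪ U)) * (Pi.single (left.{u} S) 1 : BlockNode.{u} d → ℂ) (left S') = 0 := by
      intro S' hS'
      simp only [Finset.mem_filter, Finset.mem_univ, true_and] at hS'
      have : S' ≠ S := by
        rintro rfl
        omega
      simp [this]
    rw [Finset.sum_eq_zero this]
    simp

theorem blockShift_single_middle (hη : IsSparse m η) {a : Fin d} {S U : Finset (Fin d)}
    (haS : a ∉ S) (haU : a ∉ U) (hSU : Disjoint S U) (hS : S.card = m) (hU : U.card = m)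
    (hc : η (insert a (S ∪ U)) ≠ 0) :
    blockShift m η a (Pi.single (left.{u} S) 1) =
      Pi.single (right U) (η (insert a (S ∪ U))) := by
  ext ⟨S' | U'⟩
  · change blockShift m η a _ (left S') = _
    rw [blockShift_left]
    have : a ∈ S' → S'.card ≤ m → S'.erase a ≠ S := by
      rintro h1 h2 rfl
      have := Finset.card_erase_add_one h1
      omega
    by_cases h1 : a ∈ S' <;> by_cases h2 : S'.card ≤ m <;> simp_all [Pi.single_apply]
  · change blockShift m η a _ (right U') = _
    rw [blockShift_right]
    by_cases h : U' = U
    · subst h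
      rw [if_neg haU, if_neg hU.not_lt, if_pos hU, Finset.sum_eq_single S]
      · simp
      · intro S' _ hS'
        simp [hS']
      · intro h
        simp [haS, hS, hSU] at h
    -- Sparsity excludes a second target U' ≠ U unless a ∈ U', and there the operator vanishes by
    -- definition.
    · have h0 : ∑ S' with a ∉ S' ∧ S'.card = m ∧ Disjoint S' U', η (insert a (S' ∪ U')) *
          (Pi.single (left.{u} S) 1 : BlockNode.{u} d → ℂ) (left S') = if a ∈ U' then
            ∑ S' with a ∉ S' ∧ S'.card = m ∧ Disjoint S' U', η (insert a (S' ∪ U')) *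
              (Pi.single (left.{u} S) 1 : BlockNode.{u} d → ℂ) (left S') else 0 := by
        split_ifs with haU'
        · rfl
        refine Finset.sum_eq_zero fun S' hS' => ?_
        simp only [Finset.mem_filter, Finset.mem_univ, true_and] at hS'
        by_cases hSS : S' = S
        · subst hSS
          by_contra h1
          exact h (hη.union_inj hS haS haU' haU hS'.2.2 hSU (left_ne_zero_of_mul h1) hc)
        · simp [hSS]
      rw [h0]
      by_cases haU' : a ∈ U' <;> simp [haU', h]

theorem blockShift_single_right {a : Fin d} {U : Finset (Fin d)} (ha : a ∈ U) (hU : U.card ≤ m)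
    (r : ℂ) :
    blockShift m η a (Pi.single (right.{u} U) r) = Pi.single (right (U.erase a)) r := by
  ext ⟨S' | U'⟩
  · change blockShift m η a _ (left S') = _
    simp [blockShift_left]
  · change blockShift m η a _ (right U') = _
    rw [blockShift_right]
    by_cases h : U' = U.erase a
    · subst h
      have := Finset.card_erase_add_one ha
      simp [show (U.erase a).card < m by omega, Finset.insert_erase ha]
    · have : a ∉ U' → insert a U' ≠ U := by
        rintro h1 rfl
        exact h (Finset.erase_insert h1).symm
      by_cases h1 : a ∈ U' <;> simp_all

/-- Applying the operators with indices in a block `c` one after another takes the left empty set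
to the right empty set. This is the vector obtained when the indices in `S ⊆ c` are used up. -/
noncomputable def blockChain (m : ℕ) (η : Finset (Fin d) → ℂ) (c S : Finset (Fin d)) :
    BlockNode.{u} d → ℂ :=
  if S.card ≤ m then Pi.single (left S) 1 else Pi.single (right (c \ S)) (η c)

/-- The sizes below, equal to and above m are collection, passage and deletion. The chain depends
only on the set of used indices, not on their order. -/
theorem blockShift_blockChain (hη : IsSparse m η) {c S : Finset (Fin d)} (hc : η c ≠ 0)
    (hcard : c.card = 2 * m + 1) (hS : S ⊆ c) {a : Fin d} (ha : a ∈ c) (haS : a ∉ S) :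
    blockShift m η a (blockChain.{u} m η c S) = blockChain m η c (insert a S) := by
  have hins := Finset.card_insert_of_notMem haS
  have hsub : insert a S ⊆ c := Finset.insert_subset ha hS
  rcases lt_trichotomy S.card m with h | h | h
  · rw [blockChain, blockChain, if_pos h.le, if_pos (by omega), blockShift_single_left haS h]
  · rw [blockChain, blockChain, if_pos h.le, if_neg (by omega)]
    have e : insert a (S ∪ c \ insert a S) = c := by
      rw [← Finset.insert_union, Finset.union_sdiff_of_subset hsub]
    have hcd := Finset.card_sdiff_add_card_eq_card hsub
    rw [blockShift_single_middle (U := c \ insert a S) hη haS (by simp) ?_ h (by omega)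
      (by rwa [e]), e]
    exact Finset.disjoint_sdiff.mono_left (Finset.subset_insert _ _)
  · have hcd := Finset.card_sdiff_add_card_eq_card hS
    rw [blockChain, blockChain, if_neg (by omega), if_neg (by omega),
      blockShift_single_right (by simp [ha, haS]) (by omega), Finset.sdiff_insert]

theorem sum_blockNode (F : BlockNode.{u} d → ℝ) :
    ∑ y, F y = ∑ S, F (left S) + ∑ U, F (right U) := by
  rw [← Equiv.ulift.symm.sum_comp, Fintype.sum_sum_type]
  rfl

theorem sum_comp_le_of_injOn {α β : Type*} [Fintype β] {s : Finset α} {φ : α → β}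
    (hφ : Set.InjOn φ s) {g : β → ℝ} (hg : ∀ b, 0 ≤ g b) : ∑ i ∈ s, g (φ i) ≤ ∑ b, g b := by
  classical
  rw [← Finset.sum_image hφ]
  exact Finset.sum_le_sum_of_subset_of_nonneg (Finset.subset_univ _) fun b _ _ => hg b

/-- For fixed a and U the passage sum has at most one nonzero term, by `IsSparse.union_inj` with the
roles of S and U exchanged. -/
theorem norm_sq_blockShift_right_le (hη : IsSparse m η) (h1 : ∀ c, ‖η c‖ ≤ 1) (a : Fin d)
    (x : BlockNode.{u} d → ℂ) (U : Finset (Fin d)) :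
    ‖blockShift m η a x (right U)‖ ^ 2 ≤ (if a ∉ U then ‖x (right (insert a U))‖ ^ 2 else 0) +
      ∑ S, if (a ∉ S ∧ S.card = m ∧ Disjoint S U) ∧ a ∉ U ∧ U.card = m ∧ η (insert a (S ∪ U)) ≠ 0
        then ‖x (left S)‖ ^ 2 else 0 := by
  have hs : 0 ≤ ∑ S : Finset (Fin d),
      if (a ∉ S ∧ S.card = m ∧ Disjoint S U) ∧ a ∉ U ∧ U.card = m ∧ η (insert a (S ∪ U)) ≠ 0
        then ‖x (left S)‖ ^ 2 else 0 :=
    Finset.sum_nonneg fun S _ => by split_ifs <;> positivity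
  by_cases ha : a ∈ U
  · rw [blockShift_right, if_pos ha, if_neg (not_not.2 ha)]
    simpa using hs
  rw [blockShift_right, if_neg ha, if_pos ha]
  split_ifs with h h'
  · linarith
  · refine le_add_of_nonneg_of_le (by positivity) ?_
    by_cases hex : ∃ S : Finset (Fin d), (a ∉ S ∧ S.card = m ∧ Disjoint S U) ∧
        η (insert a (S ∪ U)) ≠ 0
    · obtain ⟨S, hS, hSη⟩ := hex
      rw [Finset.sum_eq_single S]
      · have hterm : ‖η (insert a (S ∪ U)) * x (left S)‖ ^ 2 ≤ ‖x (left S)‖ ^ 2 := by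
          rw [norm_mul]
          gcongr
          exact mul_le_of_le_one_left (norm_nonneg _) (h1 _)
        refine hterm.trans (le_trans (le_of_eq ?_) (Finset.single_le_sum
          (fun S _ => by split_ifs <;> positivity) (Finset.mem_univ S)))
        rw [if_pos ⟨hS, ha, h', hSη⟩]
      · intro S' hS' hne
        simp only [Finset.mem_filter, Finset.mem_univ, true_and] at hS'
        by_contra h0
        have h2 := left_ne_zero_of_mul h0
        rw [Finset.union_comm] at h2 hSη
        exact hne (hη.union_inj h' ha hS'.1 hS.1 hS'.2.2.symm hS.2.2.symm h2 hSη)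
      · intro h2
        simp [hS.1, hS.2.1, hS.2.2] at h2
    · push Not at hex
      rw [Finset.sum_eq_zero]
      · simpa using hs
      · intro S hS
        simp only [Finset.mem_filter, Finset.mem_univ, true_and] at hS
        rw [hex S hS, zero_mul]
  · rw [norm_zero, zero_pow two_ne_zero]
    positivity

/-- Collection, deletion and passage each come from an injective partial map on basis indices. The
factor 2 counts the left mass twice, for collection and for passage; this is harmless, as the factor
1/2 in `blockOp` absorbs it. -/
theorem sum_norm_sq_blockShift_le (hη : IsSparse m η) (h1 : ∀ c, ‖η c‖ ≤ 1) (a : Fin d)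
    (x : BlockNode.{u} d → ℂ) :
    ∑ y, ‖blockShift m η a x y‖ ^ 2 ≤ 2 * ∑ y, ‖x y‖ ^ 2 := by
  have hL : ∑ S, ‖blockShift m η a x (left S)‖ ^ 2 ≤ ∑ S, ‖x (left S)‖ ^ 2 := by
    calc _ ≤ ∑ S : Finset (Fin d), if a ∈ S then ‖x (left (S.erase a))‖ ^ 2 else 0 := by
          refine Finset.sum_le_sum fun S _ => ?_
          rw [blockShift_left]
          by_cases h : a ∈ S <;> by_cases h' : S.card ≤ m <;> simp [h, h']
      _ ≤ _ := by
          rw [← Finset.sum_filter]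
          refine sum_comp_le_of_injOn (φ := fun S : Finset (Fin d) => S.erase a)
            (g := fun S => ‖x (left S)‖ ^ 2) (fun S hS S' hS' h => ?_) fun S => by positivity
          simp only [Finset.coe_filter, Finset.mem_univ, true_and, Set.mem_ofPred_eq] at hS hS' h
          rw [← Finset.insert_erase hS, ← Finset.insert_erase hS', h]
  have hR : ∑ U, ‖blockShift m η a x (right U)‖ ^ 2 ≤
      ∑ U, ‖x (right U)‖ ^ 2 + ∑ S, ‖x (left S)‖ ^ 2 := by
    refine (Finset.sum_le_sum fun U _ => norm_sq_blockShift_right_le hη h1 a x U).trans ?_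
    rw [Finset.sum_add_distrib]
    refine add_le_add ?_ ?_
    · rw [← Finset.sum_filter]
      refine sum_comp_le_of_injOn (φ := fun U : Finset (Fin d) => insert a U)
        (g := fun S => ‖x (right S)‖ ^ 2) (fun U hU U' hU' h => ?_) fun S => by positivity
      simp only [Finset.coe_filter, Finset.mem_univ, true_and, Set.mem_ofPred_eq] at hU hU' h
      rw [← Finset.erase_insert hU, ← Finset.erase_insert hU', h]
    · rw [Finset.sum_comm]
      refine Finset.sum_le_sum fun S _ => ?_
      rw [← Finset.sum_filter, Finset.sum_const, nsmul_eq_mul]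
      refine mul_le_of_le_one_left (by positivity) ?_
      have : Finset.card (Finset.univ.filter fun U : Finset (Fin d) =>
          (a ∉ S ∧ S.card = m ∧ Disjoint S U) ∧ a ∉ U ∧ U.card = m ∧
            η (insert a (S ∪ U)) ≠ 0) ≤ 1 := by
        refine Finset.card_le_one.2 fun U hU U' hU' => ?_
        simp only [Finset.mem_filter, Finset.mem_univ, true_and] at hU hU'
        exact hη.union_inj hU.1.2.1 hU.1.1 hU.2.1 hU'.2.1 hU.1.2.2 hU'.1.2.2 hU.2.2.2 hU'.2.2.2
      exact_mod_cast this
  have h0 : 0 ≤ ∑ U, ‖x (right U)‖ ^ 2 := Finset.sum_nonneg fun U _ => by positivity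
  rw [sum_blockNode, sum_blockNode]
  linarith

/-- The operators `blockShift` on the Hilbert space, with the factor `1 / 2`, which makes them
strict contractions. -/
noncomputable def blockOp (m : ℕ) (η : Finset (Fin d) → ℂ) (a : Fin d) :
    EuclideanSpace ℂ (BlockNode.{u} d) →L[ℂ] EuclideanSpace ℂ (BlockNode.{u} d) :=
  LinearMap.toContinuousLinearMap ((1 / 2 : ℂ) •
    ((WithLp.linearEquiv 2 ℂ (BlockNode d → ℂ)).symm.toLinearMap ∘ₗ blockShift m η a ∘ₗ (WithLp.linearEquiv 2 ℂ (BlockNode d → ℂ)).toLinearMap))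

theorem blockOp_apply (a : Fin d) (x : EuclideanSpace ℂ (BlockNode.{u} d)) :
    blockOp m η a x = (1 / 2 : ℂ) • WithLp.toLp 2 (blockShift m η a x.ofLp) := rfl

theorem blockOp_commute (a b : Fin d) : Commute (blockOp.{u} m η a) (blockOp m η b) := by
  ext1 x
  simp only [mul_apply_eq_comp, blockOp_apply, map_smul]
  rw [blockShift_comm]

theorem norm_blockOp_lt_one (hη : IsSparse m η) (h1 : ∀ c, ‖η c‖ ≤ 1) (a : Fin d) :
    ‖blockOp.{u} m η a‖ < 1 := by
  have h : ‖blockOp.{u} m η a‖ ≤ √2 / 2 := by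
    refine ContinuousLinearMap.opNorm_le_bound _ (by positivity) fun x => ?_
    have h2 : ‖WithLp.toLp 2 (blockShift m η a x.ofLp)‖ ≤ √2 * ‖x‖ := by
      rw [EuclideanSpace.norm_eq, EuclideanSpace.norm_eq, ← Real.sqrt_mul zero_le_two]
      exact Real.sqrt_le_sqrt (sum_norm_sq_blockShift_le hη h1 a x.ofLp)
    rw [blockOp_apply, norm_smul]
    norm_num
    linarith
  have : √2 < 2 := by
    rw [Real.sqrt_lt' two_pos]
    norm_num
  linarith

/-- The monomial of a block takes the left empty set to a multiple of the right empty set. -/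
theorem opMonomial_blockOp (hη : IsSparse m η) {c : Finset (Fin d)} (hc : η c ≠ 0)
    (hcard : c.card = 2 * m + 1) {α : Fin d →₀ ℕ} (hα : ∀ i, α i = if i ∈ c then 1 else 0) :
    opMonomial (blockOp.{u} m η) α (WithLp.toLp 2 (Pi.single (left ∅) 1)) =
      ((1 / 2 : ℂ) ^ (2 * m + 1) * η c) • WithLp.toLp 2 (Pi.single (right ∅) 1) := by
  -- Generalized to partial products: indices outside c have exponent 0, and each index in c
  -- contributes one factor 1/2 and one step of the chain.
  have key : ∀ l : List (Fin d), l.Nodup →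
      (l.map fun i => blockOp.{u} m η i ^ α i).prod (WithLp.toLp 2 (Pi.single (left ∅) 1)) =
        (1 / 2 : ℂ) ^ (c ∩ l.toFinset).card •
          WithLp.toLp 2 (blockChain.{u} m η c (c ∩ l.toFinset)) := by
    intro l hl
    induction l with
    | nil => simp [blockChain]
    | cons a l ih =>
      obtain ⟨ha, hl⟩ := List.nodup_cons.1 hl
      rw [List.map_cons, List.prod_cons, mul_apply_eq_comp, ih hl, hα,
        List.toFinset_cons]
      by_cases hac : a ∈ c
      · have hal : a ∉ c ∩ l.toFinset := by simp [ha]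
        rw [if_pos hac, pow_one, map_smul, blockOp_apply,
          blockShift_blockChain hη hc hcard Finset.inter_subset_left hac hal,
          Finset.inter_insert_of_mem hac, Finset.card_insert_of_notMem hal, smul_smul, pow_succ]
      · rw [if_neg hac, pow_zero, Finset.inter_insert_of_notMem hac]
        rfl
  have h := key (List.finRange d) (List.nodup_finRange d)
  have e : c ∩ (List.finRange d).toFinset = c := by
    ext i
    simp
  rw [e, hcard, blockChain, if_neg (by omega), Finset.sdiff_self] at h
  rw [opMonomial, List.ofFn_eq_map, h, mul_smul, ← WithLp.toLp_smul 2 (η c), ← Pi.single_smul,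
    smul_eq_mul, mul_one]

end

/-! ### Block designs from polynomials over finite fields -/

open Polynomial in
/-- The graphs of the polynomials of degree at most `m` over a finite field, at `k` points: a
family of sets of `k` elements any two of which have at most `m` common elements. -/
theorem exists_blocks {d k m q : ℕ} (hq : q.Prime) (hmk : m < k) (hkq : k ≤ q)
    (hd : k * q ≤ d) :
    ∃ B : Finset (Finset (Fin d)), B.card = q ^ (m + 1) ∧ (∀ c ∈ B, c.card = k) ∧
      ∀ c ∈ B, ∀ c' ∈ B, m < (c ∩ c').card → c = c' := by
  classical
  have : Fact q.Prime := ⟨hq⟩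
  obtain ⟨g⟩ : Nonempty (Fin k × ZMod q ↪ Fin d) := by
    apply Function.Embedding.nonempty_of_card_le
    simpa [ZMod.card] using hd
  -- The condition k ≤ q keeps the k evaluation points distinct modulo q.
  have hcast : Function.Injective fun j : Fin k => ((j : ℕ) : ZMod q) := by
    intro i j hij
    have h := (ZMod.natCast_eq_natCast_iff' _ _ _).1 hij
    rw [Nat.mod_eq_of_lt (i.2.trans_le hkq), Nat.mod_eq_of_lt (j.2.trans_le hkq)] at h
    exact Fin.ext h
  let P : (Fin (m + 1) → ZMod q) → (ZMod q)[X] := fun u =>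
    ((degreeLTEquiv (ZMod q) (m + 1)).symm u : (ZMod q)[X])
  have hPinj : Function.Injective P := fun u v h =>
    (degreeLTEquiv (ZMod q) (m + 1)).symm.injective (Subtype.ext h)
  have hPdeg : ∀ u, (P u).degree < (m + 1 : ℕ) := fun u =>
    mem_degreeLT.1 ((degreeLTEquiv (ZMod q) (m + 1)).symm u).2
  let e : (Fin (m + 1) → ZMod q) → Fin k → Fin d := fun u j => g (j, (P u).eval ((j : ℕ) : ZMod q))
  have hinj : ∀ u, Function.Injective (e u) := fun u i j h => (Prod.ext_iff.1 (g.injective h)).1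
  let blk : (Fin (m + 1) → ZMod q) → Finset (Fin d) := fun u => Finset.univ.image (e u)
  have hcard : ∀ u, (blk u).card = k := fun u => by
    rw [Finset.card_image_of_injective _ (hinj u), Finset.card_univ, Fintype.card_fin]
  have hint : ∀ u v, m < (blk u ∩ blk v).card → u = v := by
    intro u v h
    set J : Finset (Fin k) := Finset.univ.filter fun j =>
      (P u).eval ((j : ℕ) : ZMod q) = (P v).eval ((j : ℕ) : ZMod q) with hJ
    have hsub : blk u ∩ blk v ⊆ J.image (e u) := by
      intro x hx
      obtain ⟨h1, h2⟩ := Finset.mem_inter.1 hx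
      obtain ⟨i, -, rfl⟩ := Finset.mem_image.1 h1
      obtain ⟨j, -, hj⟩ := Finset.mem_image.1 h2
      have := Prod.ext_iff.1 (g.injective hj)
      obtain rfl : j = i := this.1
      exact Finset.mem_image_of_mem _ (by simpa [hJ] using this.2.symm)
    have hJm : m + 1 ≤ J.card := (Nat.succ_le_of_lt h).trans
      ((Finset.card_le_card hsub).trans Finset.card_image_le)
    apply hPinj
    refine eq_of_degrees_lt_of_eval_index_eq J (v := fun j : Fin k => ((j : ℕ) : ZMod q))
      hcast.injOn ?_ ?_ fun j hj => (Finset.mem_filter.1 hj).2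
    · exact (hPdeg u).trans_le (by exact_mod_cast hJm)
    · exact (hPdeg v).trans_le (by exact_mod_cast hJm)
  have hblk : Function.Injective blk := by
    intro u v h
    apply hint
    rw [h, Finset.inter_self, hcard]
    exact hmk
  refine ⟨Finset.univ.image blk, ?_, ?_, ?_⟩
  · rw [Finset.card_image_of_injective _ hblk]
    simp [ZMod.card]
  · intro c hc
    obtain ⟨u, -, rfl⟩ := Finset.mem_image.1 hc
    exact hcard u
  · intro c hc c' hc' h
    obtain ⟨u, -, rfl⟩ := Finset.mem_image.1 hc
    obtain ⟨v, -, rfl⟩ := Finset.mem_image.1 hc'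
    rw [hint u v h]

/-! ### Comparison of the two sides and choice of parameters -/

/-- The exponent of the square-free monomial with variables in `c`. -/
noncomputable def blockExponent {d : ℕ} (c : Finset (Fin d)) : Fin d →₀ ℕ :=
  Finsupp.equivFunOnFinite.symm fun i => if i ∈ c then 1 else 0

theorem blockExponent_apply {d : ℕ} (c : Finset (Fin d)) (i : Fin d) :
    blockExponent c i = if i ∈ c then 1 else 0 := rfl

/-- The values lie in a general normed space so that both scalar and operator monomials are covered.
-/
theorem hasSum_block_coeff {d : ℕ} {E : Type*} [NormedAddCommGroup E] [NormedSpace ℂ E]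
    (B : Finset (Finset (Fin d))) (A : Finset (Fin d) → ℂ) (g : (Fin d →₀ ℕ) → E) :
    HasSum (fun α => (∑ c ∈ B, if α = blockExponent c then A c else 0) • g α)
      (∑ c ∈ B, A c • g (blockExponent c)) := by
  simp only [Finset.sum_smul]
  refine hasSum_sum fun c _ => ?_
  have h := hasSum_single (f := fun α => (if α = blockExponent c then A c else 0) • g α)
    (blockExponent c) fun α hα => by simp [hα]
  simpa using h

/-- A block design forces an upper bound on the radius. -/
theorem pow_mul_card_le_of_blocks {d m : ℕ} {B : Finset (Finset (Fin d))} (hB : B.Nonempty)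
    (hcard : ∀ c ∈ B, c.card = 2 * m + 1)
    (hint : ∀ c ∈ B, ∀ c' ∈ B, m < (c ∩ c').card → c = c') {r : ℝ} (hr : 0 < r)
    (h : ∀ f ∈ schurClass d, dilation f r ∈ schurAglerClass.{u} d) :
    r ^ (2 * m + 1) * B.card ≤ 4 ^ (2 * m + 1) * (4 * √(B.card * (d + 1))) := by
  obtain ⟨ε, hε, hle⟩ := exists_signs_blockPoly hB hcard
  have hN : (0 : ℝ) < B.card := by exact_mod_cast hB.card_pos
  set K : ℝ := 2 ^ (2 * m + 1) * (4 * √(B.card * (d + 1))) with hK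
  have hK0 : 0 < K := by positivity
  have hf : (fun z => (K : ℂ)⁻¹ * blockPoly B ε z) ∈ schurClass d := by
    refine ⟨?_, fun z hz => ?_⟩
    · intro z _
      unfold blockPoly
      refine analyticAt_const.mul (Finset.analyticAt_fun_sum _ fun c _ => analyticAt_const.mul
        (Finset.analyticAt_fun_prod _ fun i _ => ?_))
      exact (ContinuousLinearMap.proj (R := ℂ) (φ := fun _ : Fin d => ℂ) i).analyticAt z
    · rw [norm_mul, norm_inv, Complex.norm_real, Real.norm_of_nonneg hK0.le, inv_mul_le_one₀ hK0]
      exact hle z hz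
  let A : Finset (Fin d) → ℂ := fun c => (K : ℂ)⁻¹ * (ε c * (r : ℂ) ^ (2 * m + 1))
  let a : (Fin d →₀ ℕ) → ℂ := fun α => ∑ c ∈ B, if α = blockExponent c then A c else 0
  have ha : IsPowerSeriesOf a (dilation (fun z => (K : ℂ)⁻¹ * blockPoly B ε z) r) := by
    intro z _
    have hsum := hasSum_block_coeff B A fun α => ∏ i, z i ^ α i
    suffices e : dilation (fun z => (K : ℂ)⁻¹ * blockPoly B ε z) r z =
        ∑ c ∈ B, A c • ∏ i, z i ^ blockExponent c i by
      rw [e]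
      exact hsum
    simp only [dilation, blockPoly, Finset.mul_sum]
    refine Finset.sum_congr rfl fun c hc => ?_
    have e : ∏ i, z i ^ blockExponent c i = ∏ i ∈ c, z i := by
      simp only [blockExponent_apply, pow_ite, pow_one, pow_zero]
      rw [Finset.prod_ite_mem, Finset.univ_inter]
    rw [e, Finset.prod_mul_distrib, Finset.prod_const, hcard c hc, smul_eq_mul]
    ring
  -- The operators carry the same signs as the polynomial, so each block contributes ε_c² = 1.
  let η : Finset (Fin d) → ℂ := fun c => if c ∈ B then (ε c : ℂ) else 0
  have hηB : ∀ c, η c ≠ 0 → c ∈ B := fun c hc => by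
    by_contra h0
    exact hc (if_neg h0)
  have hη : IsSparse m η := fun c c' hc hc' => hint c (hηB c hc) c' (hηB c' hc')
  have hη1 : ∀ c, ‖η c‖ ≤ 1 := by
    intro c
    by_cases hc : c ∈ B
    · rcases hε c with h1 | h1 <;> simp [η, hc, h1]
    · simp [η, hc]
  have hop := (h _ hf).2 a ha (EuclideanSpace ℂ (BlockNode.{u} d)) (blockOp m η)
    blockOp_commute (norm_blockOp_lt_one hη hη1)
  set x : EuclideanSpace ℂ (BlockNode.{u} d) :=
    WithLp.toLp 2 (Pi.single (BlockNode.left ∅) 1) with hx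
  set y : EuclideanSpace ℂ (BlockNode.{u} d) :=
    WithLp.toLp 2 (Pi.single (BlockNode.right ∅) 1) with hy
  have hx1 : ‖x‖ = 1 := by
    rw [hx, PiLp.toLp_single]
    simp
  have hy1 : ‖y‖ = 1 := by
    rw [hy, PiLp.toLp_single]
    simp
  have hval : opEval a (blockOp.{u} m η) x =
      ((K⁻¹ * r ^ (2 * m + 1) * (1 / 2) ^ (2 * m + 1) * B.card : ℝ) : ℂ) • y := by
    rw [opEval, (hasSum_block_coeff B A (opMonomial (blockOp.{u} m η))).tsum_eq,
      sum_apply]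
    have hterm : ∀ c ∈ B, (A c • opMonomial (blockOp.{u} m η) (blockExponent c)) x =
        ((K⁻¹ * r ^ (2 * m + 1) * (1 / 2) ^ (2 * m + 1) : ℝ) : ℂ) • y := by
      intro c hc
      have hηc : η c = ε c := if_pos hc
      have hsq : (ε c : ℂ) * ε c = 1 := by
        rcases hε c with h1 | h1 <;> simp [h1]
      have h0 : η c ≠ 0 := by
        rw [hηc]
        exact left_ne_zero_of_mul_eq_one hsq
      rw [smul_apply,
        opMonomial_blockOp hη h0 (hcard c hc) (blockExponent_apply c), smul_smul, hηc]
      congr 1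
      push_cast
      calc _ = (K : ℂ)⁻¹ * (r : ℂ) ^ (2 * m + 1) * (1 / 2) ^ (2 * m + 1) * (ε c * ε c) := by
            simp only [A]
            ring
        _ = _ := by rw [hsq, mul_one]
    rw [Finset.sum_congr rfl hterm, Finset.sum_const, ← Nat.cast_smul_eq_nsmul ℂ, smul_smul]
    congr 1
    push_cast
    ring
  have hfin : K⁻¹ * r ^ (2 * m + 1) * (1 / 2) ^ (2 * m + 1) * B.card ≤ 1 := by
    have h2 := (opEval a (blockOp.{u} m η)).le_of_opNorm_le hop x
    rwa [hval, norm_smul, hx1, hy1, mul_one, mul_one, Complex.norm_real,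
      Real.norm_of_nonneg (by positivity)] at h2
  have e4 : (4 : ℝ) ^ (2 * m + 1) = 2 ^ (2 * m + 1) * 2 ^ (2 * m + 1) := by
    rw [← mul_pow]
    norm_num
  rw [one_div, inv_pow] at hfin
  have h3 := mul_le_mul_of_nonneg_right hfin
    (show 0 ≤ K * 2 ^ (2 * m + 1) by positivity)
  have e5 : K⁻¹ * r ^ (2 * m + 1) * (2 ^ (2 * m + 1))⁻¹ * B.card * (K * 2 ^ (2 * m + 1)) =
      r ^ (2 * m + 1) * B.card := by
    field_simp
  rw [e5] at h3
  refine h3.trans (le_of_eq ?_)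
  rw [e4, hK]
  ring

/-- The bound on the radius obtained from the blocks over a field of `q` elements. -/
theorem pow_four_mul_le {d m q : ℕ} (hq : q.Prime) (hkq : 2 * m + 1 ≤ q)
    (hd : (2 * m + 1) * q ≤ d) (hm : Real.log d ≤ 2 * m + 1) {r : ℝ} (hr : 0 < r)
    (h : ∀ f ∈ schurClass d, dilation f r ∈ schurAglerClass.{u} d) :
    r ^ 4 * q ≤ 256 * 1024 * 9 := by
  obtain ⟨B, hBcard, hcard, hint⟩ := exists_blocks (m := m) hq (by omega) hkq hd
  have hBpos : 0 < B.card := hBcard ▸ pow_pos hq.pos _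
  have key := pow_mul_card_le_of_blocks (Finset.card_pos.1 hBpos) hcard hint hr h
  set k := 2 * m + 1 with hk
  have hN : (0 : ℝ) < B.card := by exact_mod_cast hBpos
  have hd1 : (1 : ℝ) ≤ d := by
    have : 1 ≤ k * q := Nat.mul_pos (by omega) hq.pos
    exact_mod_cast this.trans hd
  have hq1 : (1 : ℝ) ≤ q := by exact_mod_cast hq.one_lt.le
  -- The fourth power removes the square root and makes |B|² appear, which is comparable to q^k.
  have sq4 : (r ^ k) ^ 4 * (B.card : ℝ) ^ 2 ≤ (256 : ℝ) ^ k * (256 * (d + 1) ^ 2) := by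
    have h4 := pow_le_pow_left₀ (by positivity) key 4
    have e1 : (4 ^ k * (4 * √(B.card * (d + 1)))) ^ 4 =
        (256 : ℝ) ^ k * (256 * (d + 1) ^ 2) * (B.card : ℝ) ^ 2 := by
      have : √((B.card : ℝ) * (d + 1)) ^ 4 = (B.card * (d + 1)) ^ 2 := by
        rw [show 4 = 2 * 2 from rfl, pow_mul, Real.sq_sqrt (by positivity)]
      rw [mul_pow, mul_pow, this, ← pow_mul, mul_comm k 4, pow_mul]
      norm_num
      ring
    rw [e1] at h4
    have e2 : (r ^ k * B.card) ^ 4 = (r ^ k) ^ 4 * (B.card : ℝ) ^ 2 * (B.card : ℝ) ^ 2 := by ring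
    rw [e2] at h4
    exact le_of_mul_le_mul_right h4 (by positivity)
  -- |B|² = q^(2m + 2), one factor q more than q^k.
  have hqk : (q : ℝ) ^ k ≤ (B.card : ℝ) ^ 2 := by
    rw [hBcard]
    push_cast
    rw [← pow_mul]
    exact pow_le_pow_right₀ hq1 (by omega)
  -- Since log d ≤ k, the factor polynomial in d is only exponential in k and disappears into the
  -- constant after a k-th root.
  have hdk : (256 : ℝ) * (d + 1) ^ 2 ≤ (1024 * 9) ^ k := by
    have h1 : (d : ℝ) ≤ 3 ^ k := by
      calc (d : ℝ) = Real.exp (Real.log d) := (Real.exp_log (by linarith)).symm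
        _ ≤ Real.exp (k * 1) := by
            gcongr
            rw [hk]
            push_cast
            linarith
        _ = Real.exp 1 ^ k := Real.exp_nat_mul 1 k
        _ ≤ 3 ^ k := by
            gcongr
            linarith [Real.exp_one_lt_d9]
    calc (256 : ℝ) * (d + 1) ^ 2 ≤ 256 * (d + d) ^ 2 := by gcongr
      _ = 1024 * (d : ℝ) ^ 2 := by ring
      _ ≤ 1024 ^ k * (3 ^ k) ^ 2 := by
          gcongr
          exact le_self_pow₀ (by norm_num) (by omega)
      _ = (1024 * 9) ^ k := by
          rw [← pow_mul, mul_comm k 2, pow_mul, ← mul_pow]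
          norm_num
  have hpow : (r ^ 4 * q) ^ k ≤ (256 * 1024 * 9 : ℝ) ^ k := by
    calc (r ^ 4 * q) ^ k = (r ^ k) ^ 4 * (q : ℝ) ^ k := by ring
      _ ≤ (r ^ k) ^ 4 * (B.card : ℝ) ^ 2 := by gcongr
      _ ≤ 256 ^ k * (256 * (d + 1) ^ 2) := sq4
      _ ≤ 256 ^ k * (1024 * 9) ^ k := by gcongr
      _ = _ := by
          rw [← mul_pow]
          norm_num
  exact le_of_pow_le_pow_left₀ (by omega) (by norm_num) hpow

/-- For `d` large in comparison with its logarithm the parameters of the blocks can be chosen. -/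
theorem exists_block_parameters {d : ℕ} (hd : 2 ≤ d) (hlarge : 98 * Real.log d ^ 2 ≤ d) :
    ∃ m q : ℕ, q.Prime ∧ 2 * m + 1 ≤ q ∧ (2 * m + 1) * q ≤ d ∧ Real.log d ≤ 2 * m + 1 ∧
      (d : ℝ) ≤ 14 * Real.log d * q := by
  have hd2 : (2 : ℝ) ≤ d := by exact_mod_cast hd
  have hL : 0.69 < Real.log d :=
    lt_of_lt_of_le (by linarith [Real.log_two_gt_d9]) (Real.log_le_log two_pos hd2)
  set m := ⌈Real.log d⌉₊ with hm
  have h1 : Real.log d ≤ m := Nat.le_ceil _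
  have h2 : (m : ℝ) < Real.log d + 1 := Nat.ceil_lt_add_one (by linarith)
  set k := 2 * m + 1 with hk
  have hkR : (k : ℝ) ≤ 7 * Real.log d := by
    rw [hk]
    push_cast
    linarith
  -- The constant 98 is 2 · 7², from k ≤ 7 log d.
  have hk2 : 2 * k * k ≤ d := by
    have : (2 * k * k : ℝ) ≤ d := by nlinarith [(Nat.cast_nonneg k : (0 : ℝ) ≤ k)]
    exact_mod_cast this
  set n := d / (2 * k) with hn
  have hkn : k ≤ n := (Nat.le_div_iff_mul_le (by omega)).2 (by linarith)
  -- Bertrand's postulate; the 2 in n = d / (2k) leaves room for q ≤ 2n.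
  obtain ⟨q, hq, hnq, hqn⟩ := Nat.exists_prime_lt_and_le_two_mul n (by omega)
  refine ⟨m, q, hq, by omega, ?_, by linarith, ?_⟩
  · calc k * q ≤ k * (2 * n) := Nat.mul_le_mul_left _ hqn
      _ = 2 * k * n := by ring
      _ ≤ d := Nat.mul_div_le _ _
  · have h3 : d < 2 * k * (n + 1) := Nat.lt_mul_div_succ d (by omega)
    have h4 : d ≤ 2 * k * q := h3.le.trans (Nat.mul_le_mul_left _ hnq)
    have h5 : (d : ℝ) ≤ 2 * k * q := by exact_mod_cast h4
    linarith [mul_le_mul_of_nonneg_right hkR (Nat.cast_nonneg (α := ℝ) q)]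

/-- From d ≥ (log d)³ / 6 the hypothesis forces log d < 6 · 98 = 588, and 57624 = 98 · 588. For such
d the trivial bound r ≤ 1 suffices. -/
theorem le_mul_log_of_lt_log_sq {d : ℕ} (hd : 2 ≤ d) (h : (d : ℝ) < 98 * Real.log d ^ 2) :
    (d : ℝ) ≤ 57624 * Real.log d := by
  have hd2 : (2 : ℝ) ≤ d := by exact_mod_cast hd
  have hL : 0 < Real.log d := Real.log_pos (by linarith)
  have h1 := Real.pow_div_factorial_le_exp (Real.log d) hL.le 3
  rw [Real.exp_log (by linarith)] at h1
  norm_num [Nat.factorial] at h1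
  have h2 : Real.log d < 588 := by
    by_contra! h0
    nlinarith [mul_le_mul_of_nonneg_right h0 (sq_nonneg (Real.log d))]
  nlinarith

theorem theorem4 :
    ∃ c : ℝ, 0 < c ∧ ∀ d : ℕ, 2 ≤ d →
      schurAglerRadius.{u} d ≤ c * (Real.log (d : ℝ) / (d : ℝ)) ^ (1 / 4 : ℝ) := by
  -- 200^4 exceeds both 57624 and 14 · 256 · 1024 · 9.
  refine ⟨200, by norm_num, fun d hd => ?_⟩
  have hd2 : (2 : ℝ) ≤ d := by exact_mod_cast hd
  have hL : 0 < Real.log d := Real.log_pos (by linarith)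
  have hx : 0 ≤ Real.log (d : ℝ) / d := by positivity
  -- Nonnegativity of the bound covers the default value 0 of the supremum of an empty set.
  refine Real.sSup_le ?_ (by positivity)
  rintro r ⟨hr, hr1, h⟩
  have h4 : r ^ 4 ≤ 200 ^ 4 * (Real.log (d : ℝ) / d) := by
    rw [← mul_div_assoc, le_div_iff₀ (by linarith)]
    rcases lt_or_ge (d : ℝ) (98 * Real.log d ^ 2) with hs | hl
    · have h1 := le_mul_log_of_lt_log_sq hd hs
      have h2 : r ^ 4 ≤ 1 := pow_le_one₀ hr.le hr1
      nlinarith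
    · obtain ⟨m, q, hq, hkq, hkd, hm, hdq⟩ := exists_block_parameters hd hl
      have h1 := pow_four_mul_le hq hkq hkd hm hr h
      calc r ^ 4 * d ≤ r ^ 4 * (14 * Real.log d * q) := by gcongr
        _ = 14 * Real.log d * (r ^ 4 * q) := by ring
        _ ≤ 14 * Real.log d * (256 * 1024 * 9) := by gcongr
        _ ≤ _ := by nlinarith
  refine le_of_pow_le_pow_left₀ four_ne_zero (by positivity) (h4.trans (le_of_eq ?_))
  rw [mul_pow, ← Real.rpow_natCast (_ ^ (1 / 4 : ℝ)), ← Real.rpow_mul hx]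
  norm_num
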